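/- Let $(C_m)_{m\ge 0}$ be the real polynomials defined by $C_0=0$ and $$C_{m+1}(X)=\frac{m+1}{m+2}\Big((X^2+1)X^m+\sum_{k=0}^{m}\lambda_m^k\,C_k(X)\Big),$$ where $\lambda_m^k$ denotes the coefficient of $X^k$ in $C_m$. Let $\beta_m$ be the Bernoulli numbers, $\beta_m=B_m(0)$. Let $\varphi_0(x)=\ln\frac{x}{1-x}$ and let $T$ be the operator $(Tf)(x)=\int_0^1\frac{f(t)-f(x)}{t-x}\,dt$ for $x\in(0,1)$. Then for every integer $n\ge 1$, all of the following integrals (including those that define the iterates $T^{j}(\varphi_0)$, $1\le j\le 2n-1$, at every point of $(0,1)$) converge absolutely, and $$\int_0^1 T^{2n-1}(\varphi_0)(x)\,dx=\lambda_{2n}^1\,\pi^{2n}=(-1)^{n+1}\,4^n\,\beta_{2n}\,\pi^{2n},$$ $$\int_{[0,1]^{2n}}\;\sum_{k=1}^{2n}\frac{\ln(t_k)}{\prod_{i\neq k}(t_k-t_i)}\;dt_1\cdots dt_{2n}=\frac{\lambda_{2n}^1\,\pi^{2n}}{2}.$$ -/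

import Mathlib

/-- The polynomials `C_n` defined by `C_0 = 0` and
`C_{n+1} = (n+1)/(n+2) * ((X^2+1) X^n + ∑_{k=0}^n λ_n^k C_k)`, where `λ_n^k` is the coefficient of
`X^k` in `C_n`. They are the polynomials for which, together with a companion sequence `A_n`,
`a b^n = A_n(a) + C_n(b)` and `a^n b = C_n(a) + A_n(b)` whenever `2ab = a^2 + b^2 + 1`. -/
noncomputable def polyC : ℕ → Polynomial ℝ
  | 0 => 0
  | n + 1 =>
      Polynomial.C (((n : ℝ) + 1) / ((n : ℝ) + 2)) *
        ((Polynomial.X ^ 2 + 1) * Polynomial.X ^ n +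
          ∑ k : Fin (n + 1), Polynomial.C ((polyC n).coeff k.1) * polyC k.1)
  decreasing_by
    · exact Nat.lt_succ_self n
    · exact k.2

/-- `λ_n^k`, the coefficient of `X^k` in `C_n`. -/
noncomputable def lam (n k : ℕ) : ℝ := (polyC n).coeff k

/-- `φ₀(x) = ln (x / (1 - x))`. -/
noncomputable def phi0 (x : ℝ) : ℝ := Real.log (x / (1 - x))

/-- The integrand `t ↦ (f t - f x) / (t - x)` of the operator `T` at the point `x`. -/
noncomputable def opTIntegrand (f : ℝ → ℝ) (x t : ℝ) : ℝ := (f t - f x) / (t - x)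

/-- The operator `(T f)(x) = ∫_0^1 (f t - f x) / (t - x) dt`. -/
noncomputable def opT (f : ℝ → ℝ) (x : ℝ) : ℝ := ∫ t in (0 : ℝ)..1, opTIntegrand f x t

/-- The cube `[0,1]^m`. -/
def unitCube (m : ℕ) : Set (Fin m → ℝ) := Set.univ.pi fun _ => Set.Icc (0 : ℝ) 1

/-- The integrand `∑_k ln (t_k) / ∏_{i ≠ k} (t_k - t_i)`. -/
noncomputable def logSum (m : ℕ) (t : Fin m → ℝ) : ℝ :=
  ∑ k : Fin m, Real.log (t k) / ∏ i ∈ Finset.univ.erase k, (t k - t i)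

/-! Both integrals reduce to `J = ∫_0^∞ L^{2n}`, where `L(s) = ln((s+1)/s) = ∫_0^1 dt/(s+t)`. Put
`S_m(x) = ∫_0^∞ L(s)^m/(s+x) ds` for `m ≥ 1` and `S_0 = -ln`. The divided difference of `1/(s+·)` at
`x, t` is `-1/((s+x)(s+t))`, and integrating it in `t` produces a factor `-L(s)`. So `T` sends
`S_m(x)` to `-S_{m+1}(x)` and `S_m(1-x)` to `S_{m+1}(1-x)` (`opT_stieltjesLog`). Starting from `φ₀ =
-S_0(x) + S_0(1-x)`, the iterate of odd order `2n-1` is `S_{2n-1}(x) + S_{2n-1}(1-x)`, whose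
integral is `2J`. By partial fractions the cube integrand is `∫_0^∞ ∏ 1/(s+t_i) ds`, and Fubini
gives `J` (`integral_logSum`). The substitution `s = 1/(e^u-1)` turns `J` into `(2n)! ζ(2n)`, which
Euler's formula evaluates.

On the algebraic side, `λ_n^j = -(n!/j!) c_{n+1-j}` for `1 ≤ j ≤ n`, with `c_r` the Taylor
coefficients of `z cot z` (`lam_eq_cotCoeff`): the recursion for `C_n` becomes the convolution
identity expressing the Riccati equation `z y' = y - y² - z²`. -/

/-! ### Taylor coefficients of `z cot z` -/

/-- The power series of `z / (e ^ z - 1) + z / 2 = (z / 2) coth (z / 2)`. -/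
noncomputable def cothSeries : PowerSeries ℂ :=
  bernoulliPowerSeries ℂ + PowerSeries.C (1 / 2) * PowerSeries.X

theorem X_mul_derivative_bernoulliPowerSeries :
    PowerSeries.X * PowerSeries.derivative ℂ (bernoulliPowerSeries ℂ) =
      bernoulliPowerSeries ℂ - PowerSeries.X * bernoulliPowerSeries ℂ
        - bernoulliPowerSeries ℂ ^ 2 := by
  have h := bernoulliPowerSeries_mul_exp_sub_one ℂ
  have hne : (PowerSeries.exp ℂ - 1) ≠ 0 := by
    intro h0
    rw [h0, mul_zero] at h
    exact PowerSeries.X_ne_zero h.symm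
  have h' := congrArg (PowerSeries.derivative ℂ) h
  simp only [Derivation.leibniz, map_sub, PowerSeries.derivative_exp, PowerSeries.derivative_one,
    PowerSeries.derivative_X, sub_zero, smul_eq_mul] at h'
  apply mul_right_cancel₀ hne
  linear_combination PowerSeries.X * h' + (bernoulliPowerSeries ℂ - 1) * h

/-- Adding `z/2` absorbs the cross term `z B(z)` of the Bernoulli equation; the remaining square
becomes a convolution of coefficients. -/
theorem X_mul_derivative_cothSeries :
    PowerSeries.X * PowerSeries.derivative ℂ cothSeries =
      cothSeries - cothSeries ^ 2 + PowerSeries.C (1 / 4) * PowerSeries.X ^ 2 := by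
  have h := X_mul_derivative_bernoulliPowerSeries
  have h2 : (PowerSeries.C (1 / 2) : PowerSeries ℂ) * 2 = 1 := by
    rw [← map_ofNat (PowerSeries.C (R := ℂ)) 2, ← map_mul]; norm_num
  have h4 : (PowerSeries.C (1 / 4) : PowerSeries ℂ) = PowerSeries.C (1 / 2) ^ 2 := by
    rw [← map_pow]; norm_num
  simp only [cothSeries, map_add, Derivation.leibniz, PowerSeries.derivative_C,
    PowerSeries.derivative_X, smul_eq_mul, h4]
  linear_combination h + (PowerSeries.X * bernoulliPowerSeries ℂ) * h2

/-- The Taylor coefficients of `z cot z`. -/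
noncomputable def cotCoeff (r : ℕ) : ℂ := (2 * Complex.I) ^ r * PowerSeries.coeff r cothSeries

theorem cotCoeff_zero : cotCoeff 0 = 1 := by
  simp [cotCoeff, cothSeries, bernoulliPowerSeries]

theorem cotCoeff_two_mul (n : ℕ) :
    cotCoeff (2 * n) = (-4) ^ n * (bernoulli (2 * n) : ℂ) / (2 * n).factorial := by
  have h1 : PowerSeries.coeff (2 * n) cothSeries
      = (bernoulli (2 * n) : ℂ) / (2 * n).factorial := by
    simp [cothSeries, bernoulliPowerSeries, PowerSeries.coeff_X, show 2 * n ≠ 1 by lia]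
  have h2 : (2 * Complex.I) ^ 2 = (-4 : ℂ) := by rw [mul_pow, Complex.I_sq]; norm_num
  rw [cotCoeff, h1, pow_mul, h2, mul_div_assoc]

theorem sum_cotCoeff_mul (r : ℕ) :
    ∑ p ∈ Finset.HasAntidiagonal.antidiagonal r, cotCoeff p.1 * cotCoeff p.2 =
      (1 - r) * cotCoeff r - if r = 2 then 1 else 0 := by
  have h := congrArg (PowerSeries.coeff r) X_mul_derivative_cothSeries
  have hl : PowerSeries.coeff r (PowerSeries.X * PowerSeries.derivative ℂ cothSeries)
      = r * PowerSeries.coeff r cothSeries := by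
    cases r with
    | zero => simp
    | succ r =>
      rw [PowerSeries.coeff_succ_X_mul, PowerSeries.coeff_derivative]; push_cast; ring
  rw [hl, map_add, map_sub, sq, PowerSeries.coeff_mul, PowerSeries.coeff_C_mul,
    PowerSeries.coeff_X_pow] at h
  have hs : ∑ p ∈ Finset.HasAntidiagonal.antidiagonal r, cotCoeff p.1 * cotCoeff p.2 =
      (2 * Complex.I) ^ r * ∑ p ∈ Finset.HasAntidiagonal.antidiagonal r,
        PowerSeries.coeff p.1 cothSeries * PowerSeries.coeff p.2 cothSeries := by
    rw [Finset.mul_sum]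
    refine Finset.sum_congr rfl fun p hp => ?_
    rw [← Finset.HasAntidiagonal.mem_antidiagonal.mp hp, cotCoeff, cotCoeff, pow_add]
    ring
  rw [hs, cotCoeff]
  split_ifs at h ⊢ with h2
  · subst h2
    linear_combination ((2 * Complex.I) ^ 2) * h + Complex.I_sq
  · linear_combination ((2 * Complex.I) ^ r) * h

theorem sum_range_cotCoeff_mul (r : ℕ) :
    ∑ b ∈ Finset.range r, cotCoeff b * cotCoeff (r - b) =
      -r * cotCoeff r - if r = 2 then 1 else 0 := by
  have h := sum_cotCoeff_mul r
  rw [Finset.Nat.sum_antidiagonal_eq_sum_range_succ (fun a b => cotCoeff a * cotCoeff b),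
    Finset.sum_range_succ, Nat.sub_self, cotCoeff_zero] at h
  linear_combination h

/-! ### Coefficients of the polynomials `C_n` -/

theorem lam_zero (k : ℕ) : lam 0 k = 0 := by simp [lam, polyC]

theorem lam_succ (n j : ℕ) :
    lam (n + 1) j = ((n : ℝ) + 1) / (n + 2) *
      ((if j = n + 2 then 1 else 0) + (if j = n then 1 else 0) +
        ∑ k ∈ Finset.range (n + 1), lam n k * lam k j) := by
  rw [lam, polyC, Polynomial.coeff_C_mul, Polynomial.coeff_add, add_mul, ← pow_add, one_mul,
    Polynomial.coeff_add, Polynomial.coeff_X_pow, Polynomial.coeff_X_pow,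
    Polynomial.finsetSum_coeff, ← Fin.sum_univ_eq_sum_range (fun k => lam n k * lam k j),
    add_comm 2 n]
  simp only [Polynomial.coeff_C_mul, lam]

/-- The factorials telescope in `λ_n^k λ_k^j`, leaving a convolution of the `c_r`. The top
coefficient `j = n+1` exceeds the general pattern by 1; the column `j = 0` is not needed because
`C_0 = 0`. -/
theorem lam_eq_cotCoeff (n : ℕ) :
    (∀ j, n + 1 < j → lam n j = 0) ∧ lam n (n + 1) = n / (n + 1) ∧
      ∀ k q, n = k + 1 + q →
        (lam n (k + 1) : ℂ) = -(n.factorial / (k + 1).factorial) * cotCoeff (q + 1) := by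
  induction n using Nat.strong_induction_on with
  | _ n ih =>
  cases n with
  | zero =>
    refine ⟨fun j _ => lam_zero j, by simp [lam_zero], fun k q h => by lia⟩
  | succ n =>
  have top : ∀ j, n + 2 ≤ j → ∑ k ∈ Finset.range (n + 1), lam n k * lam k j = 0 := by
    intro j hj
    refine Finset.sum_eq_zero fun k hk => ?_
    rw [Finset.mem_range] at hk
    rw [(ih k hk).1 j (by lia), mul_zero]
  refine ⟨fun j hj => ?_, ?_, fun p q hn => ?_⟩
  · rw [lam_succ, top j (by lia), if_neg (by lia), if_neg (by lia)]; simp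
  · rw [lam_succ, top _ le_rfl, if_pos rfl, if_neg (by lia)]; push_cast; ring
  · obtain rfl : n = p + q := by lia
    -- At `b = 0` the second factor is the top coefficient of `C_p`; the extra `p + 1` encodes its
    -- excess 1 over the general pattern.
    have hk : ∀ b ∈ Finset.range (q + 1),
        ((lam (p + q) (p + b) * lam (p + b) (p + 1) : ℝ) : ℂ) =
          -((p + q).factorial / (p + 1).factorial) * cotCoeff (q + 1 - b) *
            ((if b = 0 then (p + 1 : ℂ) else 0) - cotCoeff b) := by
      intro b hb
      rw [Finset.mem_range] at hb
      have hf : ((p + 1).factorial : ℂ) = (p + 1) * p.factorial := by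
        push_cast [Nat.factorial_succ]; ring
      have hp0 : (p.factorial : ℂ) ≠ 0 := by exact_mod_cast p.factorial_ne_zero
      have hp1 : (p + 1 : ℂ) ≠ 0 := by exact_mod_cast p.succ_ne_zero
      cases b with
      | zero =>
        cases p with
        | zero => simp [lam_zero, cotCoeff_zero]
        | succ p =>
          have h1 := (ih (p + 1 + q) (by lia)).2.2 p q rfl
          have h2 := (ih (p + 1) (by lia)).2.1
          push_cast [add_zero, h2, if_true, cotCoeff_zero, Nat.sub_zero] at hf hp1 ⊢
          rw [h1, hf]
          field_simp
          ring
      | succ b =>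
        have h1 := (ih (p + q) (by lia)).2.2 (p + b) (q - b - 1) (by lia)
        have h2 := (ih (p + b + 1) (by lia)).2.2 p b (by lia)
        have hpb : ((p + b + 1).factorial : ℂ) ≠ 0 := by
          exact_mod_cast (p + b + 1).factorial_ne_zero
        rw [show q - b - 1 + 1 = q + 1 - (b + 1) by lia] at h1
        rw [← add_assoc, Complex.ofReal_mul, h1, h2, if_neg (by lia), zero_sub, hf]
        field_simp
    have hsum : ((∑ k ∈ Finset.range (p + q + 1), lam (p + q) k * lam k (p + 1) : ℝ) : ℂ) =
        -((p + q).factorial / (p + 1).factorial) *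
          ((p + q + 2) * cotCoeff (q + 1) + if q = 1 then 1 else 0) := by
      rw [add_assoc, Finset.sum_range_add, Finset.sum_eq_zero, zero_add, Complex.ofReal_sum,
        Finset.sum_congr rfl hk]
      · have h := sum_range_cotCoeff_mul (q + 1)
        have e : ∀ b ∈ Finset.range (q + 1),
            -((p + q).factorial / (p + 1).factorial : ℂ) * cotCoeff (q + 1 - b) *
              ((if b = 0 then (p + 1 : ℂ) else 0) - cotCoeff b) =
            -((p + q).factorial / (p + 1).factorial : ℂ) *
              ((if b = 0 then (p + 1 : ℂ) * cotCoeff (q + 1) else 0)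
                - cotCoeff b * cotCoeff (q + 1 - b)) := by
          intro b _
          split_ifs with hb
          · subst hb; simp only [Nat.sub_zero]; ring
          · ring
        rw [Finset.sum_congr rfl e, ← Finset.mul_sum, Finset.sum_sub_distrib, h,
          Finset.sum_ite_eq' (Finset.range (q + 1)) 0, if_pos (by simp)]
        simp only [show q + 1 = 2 ↔ q = 1 by lia]
        push_cast
        ring
      · intro k hk
        rw [Finset.mem_range] at hk
        rw [(ih k (by lia)).1 _ (by lia), mul_zero]
    rw [lam_succ, if_neg (by lia)]
    have hs2 : (p + q + 2 : ℂ) ≠ 0 := by exact_mod_cast (p + q + 1).succ_ne_zero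
    have hp1 : ((p + 1).factorial : ℂ) ≠ 0 := by exact_mod_cast (p + 1).factorial_ne_zero
    rw [Complex.ofReal_mul, Complex.ofReal_add, hsum, Nat.factorial_succ (p + q)]
    by_cases hq : q = 1
    · subst hq
      simp only [if_true]
      push_cast at hs2 ⊢
      field_simp
      ring
    · rw [if_neg (by lia), if_neg hq]
      push_cast
      field_simp
      ring

theorem lam_two_mul_one (n : ℕ) (hn : 1 ≤ n) :
    lam (2 * n) 1 = (-1 : ℝ) ^ (n + 1) * 4 ^ n * (bernoulli (2 * n) : ℝ) := by
  have h := (lam_eq_cotCoeff (2 * n)).2.2 0 (2 * n - 1) (by lia)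
  have hf : ((2 * n).factorial : ℂ) ≠ 0 := by exact_mod_cast (2 * n).factorial_ne_zero
  rw [show 2 * n - 1 + 1 = 2 * n by lia, cotCoeff_two_mul n, neg_pow] at h
  rw [← Complex.ofReal_inj]
  push_cast
  simp only [zero_add, Nat.factorial_one, Nat.cast_one] at h
  rw [h]
  field_simp
  ring

/-! ### Moments of `logRatio` and zeta values -/

/-- `ln ((s + 1) / s) = ∫_0^1 dt / (s + t)`. -/
noncomputable def logRatio (s : ℝ) : ℝ := Real.log ((s + 1) / s)

theorem integrableOn_pow_mul_exp_neg_mul (m : ℕ) {b : ℝ} (hb : 0 < b) :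
    MeasureTheory.IntegrableOn (fun u : ℝ => u ^ m * Real.exp (-(b * u))) (Set.Ioi 0) ∧
      ∫ u in Set.Ioi (0 : ℝ), u ^ m * Real.exp (-(b * u)) = m.factorial / b ^ (m + 1) := by
  have h := Real.integral_rpow_mul_exp_neg_mul_Ioi (a := m + 1) (by positivity) hb
  simp only [add_sub_cancel_right, Real.rpow_natCast] at h
  rw [Real.Gamma_nat_eq_factorial, ← Nat.cast_succ, Real.rpow_natCast] at h
  have h' : ∫ u in Set.Ioi (0 : ℝ), u ^ m * Real.exp (-(b * u)) = m.factorial / b ^ (m + 1) := by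
    rw [h, one_div, inv_pow, mul_comm, div_eq_mul_inv]
  -- A non-integrable function has integral 0 by convention, so a nonzero value proves
  -- integrability.
  refine ⟨MeasureTheory.Integrable.of_integral_ne_zero ?_, h'⟩
  rw [h']
  have := m.factorial_pos
  positivity

theorem exp_div_exp_sub_one_sq (u : ℝ) (hu : 0 < u) :
    ∑' n : ℕ, (n : ℝ) * Real.exp (-u) ^ n = Real.exp u / (Real.exp u - 1) ^ 2 := by
  have hu1 : Real.exp (-u) < 1 := by simpa using hu
  have h1 : 0 < Real.exp u - 1 := by simpa using hu
  rw [tsum_coe_mul_geometric_of_norm_lt_one (by rwa [Real.norm_eq_abs, Real.abs_exp]),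
    Real.exp_neg]
  have := Real.exp_pos u
  have h2 : 1 - (Real.exp u)⁻¹ = (Real.exp u - 1) / Real.exp u := by field_simp
  rw [h2]
  field_simp

/-- Expand the kernel as `∑ n e^{-nu}` and integrate termwise by the Gamma integral; the term `n =
0` vanishes on both sides. -/
theorem integral_pow_mul_exp_div_exp_sub_one_sq (m : ℕ) (hm : 2 ≤ m) :
    ∫ u in Set.Ioi (0 : ℝ), Real.exp u / (Real.exp u - 1) ^ 2 * u ^ m =
      m.factorial * ∑' n : ℕ, 1 / (n : ℝ) ^ m := by
  let F : ℕ → ℝ → ℝ := fun n u => n * (u ^ m * Real.exp (-(n * u)))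
  have hint : ∀ n, MeasureTheory.IntegrableOn (F n) (Set.Ioi 0) ∧
      ∫ u in Set.Ioi (0 : ℝ), F n u = m.factorial * (1 / (n : ℝ) ^ m) := by
    intro n
    rcases n.eq_zero_or_pos with rfl | hn
    · simp [F, show m ≠ 0 by lia]
    · have hn' : (0 : ℝ) < n := by exact_mod_cast hn
      obtain ⟨h1, h2⟩ := integrableOn_pow_mul_exp_neg_mul m hn'
      refine ⟨h1.const_mul _, ?_⟩
      rw [MeasureTheory.integral_const_mul, h2, pow_succ]
      field_simp
  have hnorm : ∀ n, ∫ u in Set.Ioi (0 : ℝ), ‖F n u‖ = m.factorial * (1 / (n : ℝ) ^ m) := by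
    intro n
    rw [← (hint n).2]
    refine MeasureTheory.setIntegral_congr_fun measurableSet_Ioi fun u hu => ?_
    have hu' : (0 : ℝ) < u := hu
    exact Real.norm_of_nonneg (by positivity)
  have hsum : Summable fun n : ℕ => (m.factorial : ℝ) * (1 / (n : ℝ) ^ m) :=
    (Real.summable_one_div_nat_pow.mpr hm).mul_left _
  have h := MeasureTheory.hasSum_integral_of_summable_integral_norm (fun n => (hint n).1)
    (by simpa only [hnorm] using hsum)
  rw [← tsum_mul_left, ← tsum_congr fun n => (hint n).2, h.tsum_eq]
  refine MeasureTheory.setIntegral_congr_fun measurableSet_Ioi fun u hu => ?_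
  simp only [F, ← exp_div_exp_sub_one_sq u hu, ← tsum_mul_right]
  refine tsum_congr fun n => ?_
  rw [← Real.exp_nat_mul]
  ring_nf

/-- The substitution `s = 1/(e^u - 1)` straightens `logRatio s` to `u`. -/
theorem integral_logRatio_pow (m : ℕ) (hm : 2 ≤ m) :
    ∫ s in Set.Ioi (0 : ℝ), logRatio s ^ m = m.factorial * ∑' n : ℕ, 1 / (n : ℝ) ^ m := by
  let f : ℝ → ℝ := fun u => (Real.exp u - 1)⁻¹
  have hpos : ∀ u ∈ Set.Ioi (0 : ℝ), 0 < Real.exp u - 1 := fun u hu => by simpa using hu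
  have hder : ∀ u ∈ Set.Ioi (0 : ℝ), HasDerivWithinAt f
      (-Real.exp u / (Real.exp u - 1) ^ 2) (Set.Ioi 0) u := fun u hu =>
    (((Real.hasDerivAt_exp u).sub_const 1).fun_inv (hpos u hu).ne').hasDerivWithinAt
  have hlog : ∀ u ∈ Set.Ioi (0 : ℝ), logRatio (f u) = u := by
    intro u hu
    have := hpos u hu
    rw [logRatio, show (f u + 1) / f u = Real.exp u by simp only [f]; field_simp; ring,
      Real.log_exp]
  have hinj : Set.InjOn f (Set.Ioi 0) := fun u hu v hv h => by rw [← hlog u hu, h, hlog v hv]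
  have himg : f '' Set.Ioi 0 = Set.Ioi 0 := by
    apply Set.Subset.antisymm
    · rintro _ ⟨u, hu, rfl⟩
      exact inv_pos.mpr (hpos u hu)
    · intro s hs
      have hs' : (0 : ℝ) < s := hs
      refine ⟨logRatio s, Real.log_pos ?_, ?_⟩
      · rw [lt_div_iff₀ hs']; linarith
      · simp only [f, logRatio]
        rw [Real.exp_log (by positivity)]
        field_simp
        ring
  have h := MeasureTheory.integral_image_eq_integral_abs_deriv_smul measurableSet_Ioi hder hinj
    (fun s => logRatio s ^ m)
  rw [himg] at h
  rw [h, ← integral_pow_mul_exp_div_exp_sub_one_sq m hm]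
  refine MeasureTheory.setIntegral_congr_fun measurableSet_Ioi fun u hu => ?_
  have := hpos u hu
  simp only [hlog u hu, smul_eq_mul]
  rw [neg_div, abs_neg, abs_of_nonneg (by positivity)]

theorem integrableOn_logRatio_pow (m : ℕ) (hm : 2 ≤ m) :
    MeasureTheory.IntegrableOn (fun s => logRatio s ^ m) (Set.Ioi 0) := by
  apply MeasureTheory.Integrable.of_integral_ne_zero
  rw [integral_logRatio_pow m hm]
  have h : 0 < ∑' n : ℕ, 1 / (n : ℝ) ^ m :=
    (Real.summable_one_div_nat_pow.mpr hm).tsum_pos (fun n => by positivity) 1 (by simp)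
  have := m.factorial_pos
  positivity

theorem integral_logRatio_pow_two_mul (n : ℕ) (hn : 1 ≤ n) :
    ∫ s in Set.Ioi (0 : ℝ), logRatio s ^ (2 * n) =
      (-1 : ℝ) ^ (n + 1) * 4 ^ n * (bernoulli (2 * n) : ℝ) * Real.pi ^ (2 * n) / 2 := by
  rw [integral_logRatio_pow _ (by lia), (hasSum_zeta_nat (show n ≠ 0 by lia)).tsum_eq]
  have h4 : (4 : ℝ) ^ n = 2 * 2 ^ (2 * n - 1) := by
    rw [← pow_succ', show 2 * n - 1 + 1 = 2 * n by lia, pow_mul]; norm_num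
  have := (2 * n).factorial_ne_zero
  rw [h4]
  field_simp

/-! ### Stieltjes transforms and the operator `T` -/

section Integrals

open MeasureTheory

theorem logRatio_pos {s : ℝ} (hs : 0 < s) : 0 < logRatio s :=
  Real.log_pos (by rw [lt_div_iff₀ hs]; linarith)

theorem measurable_logRatio : Measurable logRatio :=
  Real.measurable_log.comp (by fun_prop)

/-- This bound dominates `L^m/(s+x)` by a multiple of the integrable `L^{m+1}`. -/
theorem inv_add_le_logRatio_div {s x : ℝ} (hs : 0 < s) (hx : 0 < x) (hx1 : x ≤ 1) :
    1 / (s + x) ≤ logRatio s / x := by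
  have h1 : 1 / (s + 1) ≤ logRatio s := by
    have h := Real.one_sub_inv_le_log_of_pos (x := (s + 1) / s) (by positivity)
    rw [show 1 - ((s + 1) / s)⁻¹ = 1 / (s + 1) by field_simp; ring] at h
    exact h
  calc 1 / (s + x) ≤ 1 / (s + 1) / x := by
        rw [div_div]
        apply one_div_le_one_div_of_le (by positivity)
        nlinarith
    _ ≤ logRatio s / x := by gcongr

theorem integral_inv_add {s : ℝ} (hs : 0 < s) : ∫ t in (0 : ℝ)..1, (s + t)⁻¹ = logRatio s := by
  rw [intervalIntegral.integral_comp_add_left (fun t => t⁻¹), add_zero,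
    integral_inv_of_pos hs (by positivity), logRatio]

theorem intervalIntegrable_inv_add {s : ℝ} (hs : 0 < s) :
    IntervalIntegrable (fun t => (s + t)⁻¹) volume 0 1 := by
  apply ContinuousOn.intervalIntegrable
  rw [Set.uIcc_of_le zero_le_one]
  exact (continuous_const.add continuous_id).continuousOn.inv₀ fun t ht => by
    exact (add_pos_of_pos_of_nonneg hs ht.1).ne'

/-- Integrating a Stieltjes transform over `(0, 1)` multiplies its density by `logRatio`. -/
theorem integral_stieltjes (w : ℝ → ℝ) (hw : Measurable w) (h0 : ∀ s, 0 < s → 0 ≤ w s)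
    (hi : IntegrableOn (fun s => w s * logRatio s) (Set.Ioi 0)) :
    IntervalIntegrable (fun t => ∫ s in Set.Ioi 0, w s * (s + t)⁻¹) volume 0 1 ∧
      ∫ t in (0 : ℝ)..1, ∫ s in Set.Ioi 0, w s * (s + t)⁻¹ =
        ∫ s in Set.Ioi 0, w s * logRatio s := by
  have hm : Measurable fun p : ℝ × ℝ => w p.2 * (p.2 + p.1)⁻¹ := by fun_prop
  have hin : ∀ s ∈ Set.Ioi (0 : ℝ), ∫ t in Set.Ioc (0 : ℝ) 1, w s * (s + t)⁻¹ =
      w s * logRatio s := by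
    intro s hs
    rw [integral_const_mul, ← intervalIntegral.integral_of_le zero_le_one, integral_inv_add hs]
  have hnorm : ∀ s ∈ Set.Ioi (0 : ℝ), ∫ t in Set.Ioc (0 : ℝ) 1, ‖w s * (s + t)⁻¹‖ =
      w s * logRatio s := by
    intro s hs
    rw [← hin s hs]
    refine setIntegral_congr_fun measurableSet_Ioc fun t ht => Real.norm_of_nonneg ?_
    have h1 := ht.1
    have h2 : (0 : ℝ) < s := hs
    have := h0 s hs
    positivity
  have hint : Integrable (fun p : ℝ × ℝ => w p.2 * (p.2 + p.1)⁻¹)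
      ((volume.restrict (Set.Ioc 0 1)).prod (volume.restrict (Set.Ioi 0))) := by
    rw [integrable_prod_iff' hm.aestronglyMeasurable]
    refine ⟨?_, ?_⟩
    · filter_upwards [ae_restrict_mem measurableSet_Ioi] with s hs
      exact ((intervalIntegrable_iff_integrableOn_Ioc_of_le zero_le_one).mp
        (intervalIntegrable_inv_add hs)).const_mul _
    · exact hi.congr_fun (fun s hs => (hnorm s hs).symm) measurableSet_Ioi
  refine ⟨(intervalIntegrable_iff_integrableOn_Ioc_of_le zero_le_one).mpr hint.integral_prod_left,
    ?_⟩
  rw [intervalIntegral.integral_of_le zero_le_one, integral_integral_swap hint]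
  exact setIntegral_congr_fun measurableSet_Ioi hin

/-- The Stieltjes transforms of the powers of `logRatio`, normalized by `-ln x` for the power
zero, whose integral diverges. -/
noncomputable def stieltjesLog (m : ℕ) (x : ℝ) : ℝ :=
  if m = 0 then -Real.log x else ∫ s in Set.Ioi 0, logRatio s ^ m * (s + x)⁻¹

theorem integrableOn_logRatio_pow_mul_inv_add (m : ℕ) (hm : 1 ≤ m) {x : ℝ} (hx : 0 < x)
    (hx1 : x ≤ 1) : IntegrableOn (fun s => logRatio s ^ m * (s + x)⁻¹) (Set.Ioi 0) := by
  have hmeas := measurable_logRatio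
  refine Integrable.mono' ((integrableOn_logRatio_pow (m + 1) (by lia)).div_const x)
    (by fun_prop) ?_
  filter_upwards [ae_restrict_mem measurableSet_Ioi] with s hs
  have hs' : (0 : ℝ) < s := hs
  have hl := logRatio_pos hs'
  rw [Real.norm_of_nonneg (by positivity), pow_succ, mul_div_assoc, ← one_div]
  exact mul_le_mul_of_nonneg_left (inv_add_le_logRatio_div hs' hx hx1) (by positivity)

/-- This is the case `m = 0` of `stieltjesLog_sub`, where the two transforms diverge separately. -/
theorem integral_inv_add_mul_inv_add {x t : ℝ} (hx : 0 < x) (ht : 0 < t) :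
    (t - x) * ∫ s in Set.Ioi 0, (s + x)⁻¹ * (s + t)⁻¹ = Real.log t - Real.log x := by
  rcases eq_or_ne t x with rfl | hne
  · simp
  have hne' : t - x ≠ 0 := sub_ne_zero.mpr hne
  let F : ℝ → ℝ := fun s => (Real.log (s + x) - Real.log (s + t)) / (t - x)
  have hder : ∀ s ∈ Set.Ici (0 : ℝ), HasDerivAt F ((s + x)⁻¹ * (s + t)⁻¹) s := by
    intro s hs
    have hs' : (0 : ℝ) ≤ s := hs
    have h1 : s + x ≠ 0 := by positivity
    have h2 : s + t ≠ 0 := by positivity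
    have h := ((((hasDerivAt_id s).add_const x).log h1).sub
      (((hasDerivAt_id s).add_const t).log h2)).div_const (t - x)
    refine h.congr_deriv ?_
    simp only [id]
    field_simp
    ring
  have hlim : Filter.Tendsto F Filter.atTop (nhds 0) := by
    have h := ((Real.tendsto_log_comp_add_sub_log x).sub
      (Real.tendsto_log_comp_add_sub_log t)).div_const (t - x)
    simpa only [F, sub_sub_sub_cancel_right, sub_zero, zero_div] using h
  have h := integral_Ioi_of_hasDerivAt_of_nonneg' hder (fun s hs => by
    have hs' : (0 : ℝ) < s := hs
    positivity) hlim
  rw [h]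
  simp only [F, zero_add]
  field_simp
  ring

theorem stieltjesLog_sub (m : ℕ) {x t : ℝ} (hx : 0 < x) (hx1 : x ≤ 1) (ht : 0 < t) (ht1 : t ≤ 1) :
    stieltjesLog m t - stieltjesLog m x =
      -((t - x) * ∫ s in Set.Ioi 0, logRatio s ^ m * (s + x)⁻¹ * (s + t)⁻¹) := by
  rcases m.eq_zero_or_pos with rfl | hm
  · simp only [stieltjesLog, if_true, pow_zero, one_mul, integral_inv_add_mul_inv_add hx ht]
    ring
  · simp only [stieltjesLog, if_neg hm.ne']
    rw [← integral_sub (integrableOn_logRatio_pow_mul_inv_add m hm ht ht1)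
      (integrableOn_logRatio_pow_mul_inv_add m hm hx hx1), ← integral_const_mul, ← integral_neg]
    refine setIntegral_congr_fun measurableSet_Ioi fun s hs => ?_
    have hs' : (0 : ℝ) < s := hs
    field_simp
    ring

theorem integral_stieltjesLog_dslope (m : ℕ) {x : ℝ} (hx : 0 < x) (hx1 : x ≤ 1) :
    IntervalIntegrable (fun t => ∫ s in Set.Ioi 0, logRatio s ^ m * (s + x)⁻¹ * (s + t)⁻¹)
        volume 0 1 ∧
      ∫ t in (0 : ℝ)..1, ∫ s in Set.Ioi 0, logRatio s ^ m * (s + x)⁻¹ * (s + t)⁻¹ =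
        stieltjesLog (m + 1) x := by
  have hmeas := measurable_logRatio
  have e : ∀ s, logRatio s ^ m * (s + x)⁻¹ * logRatio s = logRatio s ^ (m + 1) * (s + x)⁻¹ :=
    fun s => by ring
  have h := integral_stieltjes (fun s => logRatio s ^ m * (s + x)⁻¹) (by fun_prop)
    (fun s hs => by have := logRatio_pos hs; positivity)
    (by simpa only [e] using integrableOn_logRatio_pow_mul_inv_add (m + 1) (by lia) hx hx1)
  simpa only [e, stieltjesLog, if_neg m.succ_ne_zero] using h

theorem ae_restrict_uIoc_eq {g h : ℝ → ℝ} {x : ℝ}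
    (H : ∀ t ∈ Set.Ioo (0 : ℝ) 1, t ≠ x → h t = g t) :
    ∀ᵐ t ∂volume.restrict (Set.uIoc 0 1), h t = g t := by
  have h1 : ∀ᵐ t : ℝ, t ≠ 1 := by simp [ae_iff]
  have h2 : ∀ᵐ t : ℝ, t ≠ x := by simp [ae_iff]
  rw [Set.uIoc_of_le zero_le_one]
  filter_upwards [ae_restrict_of_ae h1, ae_restrict_of_ae h2, ae_restrict_mem measurableSet_Ioc]
    with t ht1 htx ht
  exact H t ⟨ht.1, lt_of_le_of_ne ht.2 ht1⟩ htx

/-- Only the unreflected part changes sign: `x ↦ 1 - x` also negates the denominator `t - x`. -/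
theorem opT_stieltjesLog (j : ℕ) (f : ℝ → ℝ)
    (hf : ∀ x ∈ Set.Ioo (0 : ℝ) 1, f x = (-1) ^ (j + 1) * stieltjesLog j x + stieltjesLog j (1 - x))
    (x : ℝ) (hx : x ∈ Set.Ioo (0 : ℝ) 1) :
    IntervalIntegrable (opTIntegrand f x) volume 0 1 ∧
      opT f x = (-1) ^ (j + 2) * stieltjesLog (j + 1) x + stieltjesLog (j + 1) (1 - x) := by
  have hx0 : 0 < 1 - x := by linarith [hx.2]
  obtain ⟨hi, he⟩ := integral_stieltjesLog_dslope j hx.1 hx.2.le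
  obtain ⟨hi', he'⟩ := integral_stieltjesLog_dslope j hx0 (by linarith [hx.1])
  have hi'' := (hi'.comp_sub_left 1).symm
  have he'' := intervalIntegral.integral_comp_sub_left (a := 0) (b := 1)
    (fun t => ∫ s in Set.Ioi 0, logRatio s ^ j * (s + (1 - x))⁻¹ * (s + t)⁻¹) 1
  simp only [sub_zero, sub_self] at hi'' he''
  have hae := ae_restrict_uIoc_eq (h := opTIntegrand f x) (x := x)
    (g := fun t => (-1) ^ (j + 2) * (∫ s in Set.Ioi 0, logRatio s ^ j * (s + x)⁻¹ * (s + t)⁻¹) +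
      ∫ s in Set.Ioi 0, logRatio s ^ j * (s + (1 - x))⁻¹ * (s + (1 - t))⁻¹) (by
    intro t ht htx
    have h1 := stieltjesLog_sub j hx.1 hx.2.le ht.1 ht.2.le
    have h2 := stieltjesLog_sub j hx0 (by linarith [hx.1]) (t := 1 - t) (by linarith [ht.2])
      (by linarith [ht.1])
    rw [opTIntegrand, hf t ht, hf x hx, div_eq_iff (sub_ne_zero.mpr htx)]
    linear_combination (-1) ^ (j + 1) * h1 + h2)
  refine ⟨((hi.const_mul _).add hi'').congr_ae (Filter.EventuallyEq.symm hae), ?_⟩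
  rw [opT, intervalIntegral.integral_congr_ae_restrict hae,
    intervalIntegral.integral_add (hi.const_mul _) hi'', intervalIntegral.integral_const_mul, he,
    he'', he']

theorem opT_iterate_phi0 (j : ℕ) :
    ∀ x ∈ Set.Ioo (0 : ℝ) 1,
      (opT^[j] phi0) x = (-1) ^ (j + 1) * stieltjesLog j x + stieltjesLog j (1 - x) := by
  induction j with
  | zero =>
    intro x hx
    have : 1 - x ≠ 0 := by linarith [hx.2]
    rw [Function.iterate_zero_apply, phi0, Real.log_div hx.1.ne' this]
    simp [stieltjesLog, sub_eq_add_neg]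
  | succ j ih =>
    intro x hx
    rw [Function.iterate_succ_apply']
    exact (opT_stieltjesLog j _ ih x hx).2

theorem integral_opT_iterate_phi0 (n : ℕ) (hn : 1 ≤ n) :
    IntervalIntegrable (opT^[2 * n - 1] phi0) volume 0 1 ∧
      ∫ x in (0 : ℝ)..1, (opT^[2 * n - 1] phi0) x =
        2 * ∫ s in Set.Ioi 0, logRatio s ^ (2 * n) := by
  have hmeas := measurable_logRatio
  have e : ∀ s, logRatio s ^ (2 * n - 1) * logRatio s = logRatio s ^ (2 * n) :=
    fun s => by rw [← pow_succ]; congr 1; lia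
  have h := integral_stieltjes (fun s => logRatio s ^ (2 * n - 1)) (by fun_prop)
    (fun s hs => by have := logRatio_pos hs; positivity)
    (by simpa only [e] using integrableOn_logRatio_pow (2 * n) (by lia))
  have hg : (fun x => ∫ s in Set.Ioi 0, logRatio s ^ (2 * n - 1) * (s + x)⁻¹) =
      stieltjesLog (2 * n - 1) := by
    ext x; rw [stieltjesLog, if_neg (by lia)]
  simp only [e] at h
  rw [hg] at h
  obtain ⟨hi, he⟩ := h
  have hi'' := (hi.comp_sub_left 1).symm
  have he'' := intervalIntegral.integral_comp_sub_left (a := 0) (b := 1)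
    (stieltjesLog (2 * n - 1)) 1
  simp only [sub_zero, sub_self] at hi'' he''
  have hae := ae_restrict_uIoc_eq (h := opT^[2 * n - 1] phi0) (x := 0)
    (g := fun t => stieltjesLog (2 * n - 1) t + stieltjesLog (2 * n - 1) (1 - t)) (by
    intro t ht _
    rw [opT_iterate_phi0 _ t ht, show 2 * n - 1 + 1 = 2 * n by lia, pow_mul]
    simp)
  refine ⟨(hi.add hi'').congr_ae (Filter.EventuallyEq.symm hae), ?_⟩
  rw [intervalIntegral.integral_congr_ae_restrict hae, intervalIntegral.integral_add hi hi'', he'',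
    he]
  ring

/-! ### Divided differences of the logarithm and the cube integral -/

/-- Partial fractions, read off from Lagrange interpolation of the constant 1 at the nodes `-t i`.
-/
theorem sum_nodalWeight_neg_mul_inv {m : ℕ} (hm : 1 ≤ m) {t : Fin m → ℝ}
    (ht : Function.Injective t) {s : ℝ} (hs : ∀ i, s + t i ≠ 0) :
    ∑ i, Lagrange.nodalWeight Finset.univ (fun i => -t i) i * (s + t i)⁻¹ = ∏ i, (s + t i)⁻¹ := by
  have : Nonempty (Fin m) := ⟨⟨0, hm⟩⟩
  have hinj : Set.InjOn (fun i => -t i) (Finset.univ : Finset (Fin m)) :=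
    (neg_injective.comp ht).injOn
  have h := Lagrange.eval_interpolate_not_at_node (s := Finset.univ) (v := fun i => -t i)
    (1 : Fin m → ℝ) (x := s) (fun i _ h => hs i (by rw [h]; ring))
  rw [Lagrange.interpolate_one hinj Finset.univ_nonempty, Polynomial.eval_one,
    Lagrange.eval_nodal] at h
  simp only [sub_neg_eq_add, Pi.one_apply, mul_one] at h
  rw [Finset.prod_inv_distrib]
  exact eq_inv_of_mul_eq_one_right h.symm

/-- The sum is the coefficient of `X^(m-1)` in the interpolated constant 1. -/
theorem sum_nodalWeight_neg_eq_zero {m : ℕ} (hm : 2 ≤ m) {t : Fin m → ℝ}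
    (ht : Function.Injective t) :
    ∑ i, Lagrange.nodalWeight Finset.univ (fun i => -t i) i = 0 := by
  have hinj : Set.InjOn (fun i => -t i) (Finset.univ : Finset (Fin m)) :=
    (neg_injective.comp ht).injOn
  have h := Lagrange.coeff_eq_sum hinj (P := 1) (by simp; lia)
  rw [Polynomial.coeff_one, if_neg (by simp; lia)] at h
  simp only [Lagrange.nodalWeight, Finset.prod_inv_distrib]
  simpa using h.symm

theorem logSum_eq_neg_sum_nodalWeight {m : ℕ} (hm : Even m) (hm1 : 1 ≤ m) (t : Fin m → ℝ) :
    logSum m t = -∑ i, Lagrange.nodalWeight Finset.univ (fun i => -t i) i * Real.log (t i) := by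
  rw [logSum, ← Finset.sum_neg_distrib]
  refine Finset.sum_congr rfl fun k _ => ?_
  -- Passing to the nodes `-t i` flips `m - 1` signs, an odd number.
  have hodd : Odd (Finset.univ.erase k).card := by
    rw [Finset.card_erase_of_mem (Finset.mem_univ k), Finset.card_univ, Fintype.card_fin]
    exact Nat.Even.sub_odd hm1 hm odd_one
  have hp : ∏ i ∈ Finset.univ.erase k, (-t k - -t i) = -∏ i ∈ Finset.univ.erase k, (t k - t i) := by
    rw [← neg_one_mul (∏ i ∈ _, (t k - t i)), ← hodd.neg_one_pow, ← Finset.prod_const,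
      ← Finset.prod_mul_distrib]
    exact Finset.prod_congr rfl fun i _ => by ring
  rw [Lagrange.nodalWeight, Finset.prod_inv_distrib, hp, inv_neg, neg_mul, neg_neg, div_eq_inv_mul]

/-- The divided differences of the logarithm at evenly many points as Stieltjes integrals. -/
theorem integral_prod_inv_add_eq_logSum {m : ℕ} (hm : Even m) (hm2 : 2 ≤ m) {t : Fin m → ℝ}
    (ht : Function.Injective t) (hpos : ∀ i, 0 < t i) :
    ∫ s in Set.Ioi (0 : ℝ), ∏ i, (s + t i)⁻¹ = logSum m t := by
  let w := Lagrange.nodalWeight Finset.univ (fun i => -t i)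
  let F : ℝ → ℝ := fun s => ∑ i, w i * Real.log (s + t i)
  have hadd : ∀ s ∈ Set.Ici (0 : ℝ), ∀ i, s + t i ≠ 0 := fun s hs i =>
    (add_pos_of_nonneg_of_pos hs (hpos i)).ne'
  have hder : ∀ s ∈ Set.Ici (0 : ℝ), HasDerivAt F (∏ i, (s + t i)⁻¹) s := by
    intro s hs
    rw [← sum_nodalWeight_neg_mul_inv (by lia) ht (hadd s hs)]
    refine HasDerivAt.fun_sum fun i _ => HasDerivAt.const_mul _ ?_
    simpa using ((hasDerivAt_id s).add_const (t i)).log (hadd s hs i)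
  -- Zero total weight cancels the growth `log s` of the antiderivative at infinity.
  have hw : ∑ i, w i = 0 := sum_nodalWeight_neg_eq_zero hm2 ht
  have hlim : Filter.Tendsto F Filter.atTop (nhds 0) := by
    have h := tendsto_finsetSum Finset.univ fun i _ =>
      (Real.tendsto_log_comp_add_sub_log (t i)).const_mul (w i)
    simp only [mul_sub, Finset.sum_sub_distrib, ← Finset.sum_mul, hw, zero_mul, sub_zero,
      mul_zero, Finset.sum_const_zero] at h
    exact h
  rw [integral_Ioi_of_hasDerivAt_of_nonneg' hder (fun s hs => Finset.prod_nonneg fun i _ =>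
    inv_nonneg.mpr (add_pos hs (hpos i)).le) hlim, logSum_eq_neg_sum_nodalWeight hm (by lia)]
  simp [F, w]

/-- Each diagonal `t i = t j` is a proper subspace, hence null. -/
theorem ae_injective (m : ℕ) : ∀ᵐ t : Fin m → ℝ, Function.Injective t := by
  have h : ∀ i j : Fin m, i ≠ j → ∀ᵐ t : Fin m → ℝ, t i ≠ t j := by
    intro i j hij
    let S : Submodule ℝ (Fin m → ℝ) := LinearMap.ker
      (LinearMap.proj (R := ℝ) (φ := fun _ : Fin m => ℝ) i - LinearMap.proj j)
    have hS : S ≠ ⊤ := by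
      intro hS
      have h1 : (Pi.single i 1 : Fin m → ℝ) ∈ S := hS ▸ Submodule.mem_top
      simp [S, hij] at h1
    have h0 := Measure.addHaar_submodule volume S hS
    rw [ae_iff]
    convert h0 using 2
    ext t
    simp [S, sub_eq_zero]
  have h' : ∀ᵐ t : Fin m → ℝ, ∀ i j : Fin m, i ≠ j → t i ≠ t j := by
    simp only [ae_all_iff]
    exact h
  filter_upwards [h'] with t ht i j hij
  by_contra hne
  exact ht i j hne hij

theorem restrict_unitCube (m : ℕ) :
    volume.restrict (unitCube m) =
      Measure.pi fun _ : Fin m => volume.restrict (Set.Ioc (0 : ℝ) 1) := by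
  rw [unitCube, volume_pi, Measure.restrict_pi_pi]
  simp only [Measure.restrict_congr_set (Ioc_ae_eq_Icc (μ := volume))]

/-- For fixed `s` the integral over the cube factors into `m` copies of `logRatio s`; positivity of
the integrand makes this also the integrability bound for Fubini. -/
theorem integral_logSum {m : ℕ} (hm : Even m) (hm2 : 2 ≤ m) :
    IntegrableOn (logSum m) (unitCube m) ∧
      ∫ t in unitCube m, logSum m t = ∫ s in Set.Ioi 0, logRatio s ^ m := by
  let μ : Measure (Fin m → ℝ) := Measure.pi fun _ => volume.restrict (Set.Ioc (0 : ℝ) 1)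
  have hae : ∀ᵐ t ∂μ, (∫ s in Set.Ioi (0 : ℝ), ∏ i, (s + t i)⁻¹) = logSum m t := by
    have hinj : ∀ᵐ t ∂μ, Function.Injective t := by
      rw [show μ = volume.restrict (unitCube m) from (restrict_unitCube m).symm]
      exact ae_restrict_of_ae (ae_injective m)
    have hpos : ∀ᵐ t ∂μ, ∀ i, 0 < t i := by
      rw [ae_all_iff]
      exact fun i => Measure.tendsto_eval_ae_ae.eventually
        ((ae_restrict_mem measurableSet_Ioc).mono fun x hx => hx.1)
    filter_upwards [hinj, hpos] with t h1 h2
    exact integral_prod_inv_add_eq_logSum hm hm2 h1 h2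
  have hin : ∀ s ∈ Set.Ioi (0 : ℝ), ∫ t, ∏ i, (s + t i)⁻¹ ∂μ = logRatio s ^ m := by
    intro s hs
    rw [integral_fintype_prod_eq_pow (fun t => (s + t)⁻¹),
      ← intervalIntegral.integral_of_le zero_le_one, integral_inv_add hs, Fintype.card_fin]
  have hnorm : ∀ s ∈ Set.Ioi (0 : ℝ), ∫ t, ‖∏ i, (s + t i)⁻¹‖ ∂μ = logRatio s ^ m := by
    intro s hs
    simp only [norm_prod]
    rw [integral_fintype_prod_eq_pow (fun t => ‖(s + t)⁻¹‖), Fintype.card_fin,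
      ← integral_inv_add hs, intervalIntegral.integral_of_le zero_le_one]
    congr 1
    exact setIntegral_congr_fun measurableSet_Ioc fun t ht => Real.norm_of_nonneg
      (inv_nonneg.mpr (add_pos hs ht.1).le)
  have hint : Integrable (fun p : (Fin m → ℝ) × ℝ => ∏ i, (p.2 + p.1 i)⁻¹)
      (μ.prod (volume.restrict (Set.Ioi 0))) := by
    rw [integrable_prod_iff' (by fun_prop)]
    refine ⟨?_, ?_⟩
    · filter_upwards [ae_restrict_mem measurableSet_Ioi] with s hs
      exact Integrable.fintype_prod fun _ =>
        (intervalIntegrable_iff_integrableOn_Ioc_of_le zero_le_one).mp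
          (intervalIntegrable_inv_add hs)
    · exact (integrableOn_logRatio_pow m hm2).congr_fun (fun s hs => (hnorm s hs).symm)
        measurableSet_Ioi
  rw [IntegrableOn, restrict_unitCube]
  refine ⟨hint.integral_prod_left.congr hae, ?_⟩
  rw [← integral_congr_ae hae, integral_integral_swap hint]
  exact setIntegral_congr_fun measurableSet_Ioi hin

end Integrals

theorem mainTheorem10 (n : ℕ) (hn : 1 ≤ n) :
    -- the value of the coefficient
    (lam (2 * n) 1 * Real.pi ^ (2 * n) =
      (-1 : ℝ) ^ (n + 1) * 4 ^ n * (bernoulli (2 * n) : ℝ) * Real.pi ^ (2 * n)) ∧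
    -- the integrals defining the iterates up to order `2n - 1` converge on `(0,1)`
    (∀ j < 2 * n - 1, ∀ x ∈ Set.Ioo (0 : ℝ) 1,
      IntervalIntegrable (opTIntegrand (opT^[j] phi0) x) MeasureTheory.volume 0 1) ∧
    -- the integral of the iterate
    IntervalIntegrable (opT^[2 * n - 1] phi0) MeasureTheory.volume 0 1 ∧
    (∫ x in (0 : ℝ)..1, (opT^[2 * n - 1] phi0) x) = lam (2 * n) 1 * Real.pi ^ (2 * n) ∧
    -- the `2n`-fold integral
    MeasureTheory.IntegrableOn (logSum (2 * n)) (unitCube (2 * n)) MeasureTheory.volume ∧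
    (∫ t in unitCube (2 * n), logSum (2 * n) t) = lam (2 * n) 1 * Real.pi ^ (2 * n) / 2 := by
  have hJ : ∫ s in Set.Ioi (0 : ℝ), logRatio s ^ (2 * n) =
      lam (2 * n) 1 * Real.pi ^ (2 * n) / 2 := by
    rw [lam_two_mul_one n hn, integral_logRatio_pow_two_mul n hn]
  obtain ⟨hT, hT'⟩ := integral_opT_iterate_phi0 n hn
  obtain ⟨hS, hS'⟩ := integral_logSum (even_two_mul n) (by lia)
  refine ⟨by rw [lam_two_mul_one n hn],
    fun j _ x hx => (opT_stieltjesLog j _ (opT_iterate_phi0 j) x hx).1, hT, ?_, hS, hS'.trans hJ⟩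
  rw [hT', hJ]
  ring
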